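/- Let $\varphi\in L^1(\mathbb R)$ be complex valued, with non-compact (essential) support. For $s\ge 0$ put $p(s)=-\log\int_{|t|\ge s}|\varphi(t)|\,dt$ and assume that $\lim_{s\to\infty}p(s)/s=\infty$. Let $p^*(s)=\sup_{t\ge 0}\,[st-p(t)]$ be the Young dual of $p$, and let $\Phi(z)=\int_{-\infty}^{\infty}e^{zt}\varphi(t)\,dt$ for $z\in\mathbb C$. Let $q>\tfrac12$. Then there is $\varepsilon_0>0$, depending only on $\varphi$ and $q$, such that for every $\varepsilon\in(0,\varepsilon_0)$ the equation $$\Big[\big(q+\tfrac12\big)\log R_\varepsilon+\log(15e^3)\Big]\Big[1+\log(2R_\varepsilon)+p^*(2R_\varepsilon+1)\Big]=-\log\varepsilon$$ has exactly one solution $R_\varepsilon\ge 1$, and, for every $\varepsilon\in(0,\varepsilon_0)$, $$m\big(\{z\in\mathbb C:\ |\Phi(z)|\le\varepsilon,\ |z|\le R_\varepsilon\}\big)\le R_\varepsilon^{-q+\frac12},$$ where $m$ is Lebesgue measure on $\mathbb C$. Moreover $$\lim_{\varepsilon\to 0^+}\frac{\log p^*(2R_\varepsilon+1)}{\log\log\frac1\varepsilon}=1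 .$$ -/

import Mathlib

open MeasureTheory Filter Topology

namespace SmallValue

/-- The support of `φ`, as an element of `L¹(ℝ)`, is compact: `φ` vanishes almost everywhere
outside some compact set. -/
def HasEssCompactSupport (φ : ℝ → ℂ) : Prop :=
  ∃ K : Set ℝ, IsCompact K ∧ ∀ᵐ t : ℝ, t ∉ K → φ t = 0

/-- `p(s) = -log ∫_{|t| ≥ s} |φ(t)| dt`. The integral is positive for every `s` as soon as the
support of `φ` is not compact, so that `p` is then finite everywhere. -/
noncomputable def tailExponent (φ : ℝ → ℂ) (s : ℝ) : ℝ :=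
  -Real.log (∫ t in {t : ℝ | s ≤ |t|}, ‖φ t‖)

/-- The Young dual `p*(s) = sup_{t ≥ 0} (s t - p(t))`. The supremum is over a set that is bounded
above whenever `p` is bounded below and `p(t) / t → ∞`. -/
noncomputable def youngDual (p : ℝ → ℝ) (s : ℝ) : ℝ :=
  ⨆ t : Set.Ici (0 : ℝ), (s * (t : ℝ) - p (t : ℝ))

/-- The two-sided Laplace transform `Φ(z) = ∫ e^{z t} φ(t) dt`. -/
noncomputable def laplace (φ : ℝ → ℂ) (z : ℂ) : ℂ :=
  ∫ t : ℝ, Complex.exp (z * (t : ℂ)) * φ t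

/-- `R ≥ 1` solves
`[(q + 1/2) log R + log (15 e³)] [1 + log (2 R) + p*(2 R + 1)] = - log ε`. -/
def IsRadius (φ : ℝ → ℂ) (q ε R : ℝ) : Prop :=
  1 ≤ R ∧
    ((q + 1 / 2) * Real.log R + Real.log (15 * Real.exp 3)) *
      (1 + Real.log (2 * R) + youngDual (tailExponent φ) (2 * R + 1)) = -Real.log ε

end SmallValue

/-! `Φ` is entire, and the layer-cake formula gives `|Φ(z)| ≤ (1 + |Re z|) exp p*(|Re z| + 1)`.
After the zero at the origin is divided out, the zeros in a disc slightly larger than `|z| ≤ R` are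
counted by Jensen's formula on `|z| = 2R`. Once they are replaced by their reflections, the function
has no zeros in that disc, and Borel–Carathéodory bounds it below. Hence on `|z| ≤ R`, `|Φ|`
dominates a normalized product over `N` roots times `exp(-(40 L + K))`, where `L = 1 + log 2R +
p*(2R+1)` (`exists_laplace_lower_bound`). Such a product is tiny only on a set of small area
(`volume_rootProd_le`).

The delicate point is `N ≤ L` with constant one. Convexity of `p*` bounds `p*(|Re z| + 1)` on the
circle by an affine function of `|Re z|`, whose mean brings in the factor `2/π`, and `2/π <
log(40/21)`. At the scale `r = R^((1/2-q)/2)` the roots cost about `N (q/2 + 3/4) log R`, against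
the available `L (q + 1/2) log R`. Since `q > 1/2`, a surplus of order `L log R` remains; it absorbs
`40 L + K` and brings the area below `r²`.

For the limit, `p*(2R+1) ≥ R` eventually, so after taking logarithms the factor of order `log R` and
the summand `1 + log 2R` are negligible. -/

namespace SmallValue

/-! ### Jensen's formula and splitting off zeros -/

/-- The product `∏ (z - a)` over a multiset of roots. -/
noncomputable def rootProd (s : Multiset ℂ) (z : ℂ) : ℂ := (s.map fun a => z - a).prod

/-- In Jensen's formula the zeros in the disc contribute only nonnegative terms `log (ρ / |u|)`. -/
lemma log_norm_le_circleAverage {h : ℂ → ℂ} (hh : Differentiable ℂ h) (h0 : h 0 ≠ 0) {ρ : ℝ}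
    (hρ : 0 < ρ) :
    Real.log ‖h 0‖ ≤ Real.circleAverage (fun z => Real.log ‖h z‖) 0 ρ := by
  have han : AnalyticOnNhd ℂ h (Metric.closedBall 0 |ρ|) :=
    fun z _ => hh.analyticAt z
  rw [han.circleAverage_log_norm hρ.ne' h0]
  have : 0 ≤ ∑ᶠ u, (MeromorphicOn.divisor h (Metric.closedBall 0 |ρ|) u : ℝ) *
      Real.log (ρ * ‖0 - u‖⁻¹) := by
    refine finsum_nonneg fun u => ?_
    by_cases hu : u ∈ Metric.closedBall (0 : ℂ) |ρ|
    · refine mul_nonneg ?_ ?_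
      · exact_mod_cast MeromorphicOn.AnalyticOnNhd.divisor_nonneg han u
      · rcases eq_or_ne u 0 with rfl | hu0
        · simp
        · refine Real.log_nonneg ?_
          rw [abs_of_pos hρ, mem_closedBall_zero_iff] at hu
          rw [zero_sub, norm_neg, ← div_eq_mul_inv, one_le_div (norm_pos_iff.2 hu0)]
          exact hu
    · rw [Function.locallyFinsuppWithin.apply_eq_zero_of_notMem _ hu]
      simp
  linarith

lemma differentiable_dslope {f : ℂ → ℂ} (hf : Differentiable ℂ f) (a : ℂ) :
    Differentiable ℂ (dslope f a) := by
  rw [← differentiableOn_univ] at hf ⊢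
  exact (Complex.differentiableOn_dslope univ_mem).2 hf

lemma eq_sub_mul_dslope {f : ℂ → ℂ} {a : ℂ} (ha : f a = 0) (z : ℂ) :
    f z = (z - a) * dslope f a z := by
  have := sub_smul_dslope f a z
  rw [ha, sub_zero, smul_eq_mul] at this
  exact this.symm

/-- A nonzero entire function is `z ^ m` times an entire function not vanishing at `0`. -/
lemma exists_eq_pow_mul {f : ℂ → ℂ} (hf : Differentiable ℂ f) {w : ℂ} (hw : f w ≠ 0) :
    ∃ (m : ℕ) (g : ℂ → ℂ), Differentiable ℂ g ∧ g 0 ≠ 0 ∧ ∀ z, f z = z ^ m * g z := by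
  classical
  have htop : analyticOrderAt f 0 ≠ ⊤ := by
    intro h
    rw [analyticOrderAt_eq_top] at h
    have := AnalyticOnNhd.eq_of_eventuallyEq (f := f) (g := fun _ => 0)
      (fun z _ => hf.analyticAt z) (fun z _ => analyticAt_const) h
    exact hw (congrFun this w)
  -- The finite order of vanishing at `0` bounds the exponents, so a greatest one exists; its
  -- cofactor cannot vanish at `0`.
  have hb : ∀ m : ℕ, (∃ g : ℂ → ℂ, Differentiable ℂ g ∧ ∀ z, f z = z ^ m * g z) →
      m ≤ (analyticOrderAt f 0).toNat := by
    rintro m ⟨g, hg, hfg⟩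
    have : (m : ℕ∞) ≤ analyticOrderAt f 0 := by
      rw [natCast_le_analyticOrderAt (hf.analyticAt 0)]
      exact ⟨g, hg.analyticAt 0, Eventually.of_forall fun z => by simp [hfg z]⟩
    rw [← ENat.natCast_toNat htop] at this
    exact_mod_cast this
  let Q : ℕ → Prop := fun m => ∃ g : ℂ → ℂ, Differentiable ℂ g ∧ ∀ z, f z = z ^ m * g z
  have hQ0 : Q 0 := ⟨f, hf, fun z => by simp⟩
  have hQ := Nat.findGreatest_spec (P := Q) (Nat.zero_le (analyticOrderAt f 0).toNat) hQ0
  set m := Nat.findGreatest Q (analyticOrderAt f 0).toNat with hm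
  obtain ⟨g, hg, hfg⟩ := hQ
  refine ⟨m, g, hg, fun h0 => ?_, hfg⟩
  have hsucc : Q (m + 1) := ⟨dslope g 0, differentiable_dslope hg 0, fun z => by
    rw [hfg z, eq_sub_mul_dslope h0 z]; ring⟩
  exact absurd (Nat.le_findGreatest (hb _ hsucc) hsucc) (by omega)

/-- The numerator of the Blaschke product of radius `ρ` with the given zeros. -/
noncomputable def reflProd (ρ : ℝ) (s : Multiset ℂ) (z : ℂ) : ℂ :=
  (s.map fun a => (ρ ^ 2 - (starRingEnd ℂ) a * z) / ρ).prod

lemma differentiable_reflProd (ρ : ℝ) (s : Multiset ℂ) : Differentiable ℂ (reflProd ρ s) := by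
  induction s using Multiset.induction_on with
  | empty =>
    have : reflProd ρ 0 = fun _ => 1 := by funext z; simp [reflProd]
    rw [this]
    exact differentiable_const 1
  | cons a s ih =>
    have : reflProd ρ (a ::ₘ s) =
        fun z => ((ρ ^ 2 - (starRingEnd ℂ) a * z) / ρ) * reflProd ρ s z := by
      funext z; simp [reflProd]
    rw [this]
    have h1 : Differentiable ℂ fun z : ℂ => ((ρ : ℂ) ^ 2 - (starRingEnd ℂ) a * z) / ρ := by
      fun_prop
    exact h1.mul ih

/-- On the circle `ρ² = conj z * z`, so a factor `conj z` comes out. -/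
lemma norm_sq_sub_conj_mul {ρ : ℝ} {z : ℂ} (a : ℂ) (hz : ‖z‖ = ρ) :
    ‖(ρ : ℂ) ^ 2 - (starRingEnd ℂ) a * z‖ = ρ * ‖z - a‖ := by
  have h1 : ((ρ : ℂ)) ^ 2 = (starRingEnd ℂ) z * z := by
    rw [mul_comm, Complex.mul_conj, Complex.normSq_eq_norm_sq, hz]; push_cast; rfl
  rw [h1, ← sub_mul, ← map_sub, norm_mul, RCLike.norm_conj, hz, mul_comm]

lemma norm_reflProd_of_norm_eq {ρ : ℝ} (hρ : 0 < ρ) (s : Multiset ℂ) {z : ℂ} (hz : ‖z‖ = ρ) :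
    ‖reflProd ρ s z‖ = ‖rootProd s z‖ := by
  induction s using Multiset.induction_on with
  | empty => simp [reflProd, rootProd]
  | cons a s ih =>
    simp only [reflProd, rootProd, Multiset.map_cons, Multiset.prod_cons, norm_mul] at ih ⊢
    rw [ih, norm_div, norm_sq_sub_conj_mul a hz, Complex.norm_real, Real.norm_eq_abs,
      abs_of_pos hρ, mul_div_cancel_left₀ _ hρ.ne']

lemma norm_reflProd_zero {ρ : ℝ} (hρ : 0 < ρ) (s : Multiset ℂ) :
    ‖reflProd ρ s 0‖ = ρ ^ s.card := by
  induction s using Multiset.induction_on with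
  | empty => simp [reflProd]
  | cons a s ih =>
    simp only [reflProd, Multiset.map_cons, Multiset.prod_cons, norm_mul, Multiset.card_cons]
      at ih ⊢
    rw [ih, pow_succ' ρ s.card]
    congr 1
    simp only [mul_zero, sub_zero, norm_div, norm_pow, Complex.norm_real, Real.norm_eq_abs,
      abs_of_pos hρ]
    field_simp

lemma norm_rootProd_zero_le {r : ℝ} {s : Multiset ℂ} (hs : ∀ a ∈ s, ‖a‖ ≤ r) :
    ‖rootProd s 0‖ ≤ r ^ s.card := by
  induction s using Multiset.induction_on with
  | empty => simp [rootProd]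
  | cons a s ih =>
    simp only [rootProd, Multiset.map_cons, Multiset.prod_cons, norm_mul, Multiset.card_cons]
      at ih ⊢
    have ha := hs a (Multiset.mem_cons_self a s)
    rw [pow_succ', zero_sub, norm_neg]
    exact mul_le_mul ha (ih fun b hb => hs b (Multiset.mem_cons_of_mem hb)) (norm_nonneg _)
      ((norm_nonneg _).trans ha)

lemma reflProd_ne_zero {ρ r : ℝ} (hr : r < ρ) {s : Multiset ℂ} (hs : ∀ a ∈ s, ‖a‖ ≤ r)
    {z : ℂ} (hz : ‖z‖ ≤ ρ) (hρ : 0 < ρ) : reflProd ρ s z ≠ 0 := by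
  intro h
  obtain ⟨a, ha, h⟩ := Multiset.mem_map.1 (Multiset.prod_eq_zero_iff.1 h)
  rw [div_eq_zero_iff] at h
  rcases h with h | h
  · have h2 := congrArg norm (sub_eq_zero.1 h)
    rw [norm_mul, RCLike.norm_conj, norm_pow, Complex.norm_real, Real.norm_eq_abs,
      abs_of_pos hρ] at h2
    have := hs a ha
    nlinarith [norm_nonneg a, norm_nonneg z]
  · exact hρ.ne' (by exact_mod_cast h)

/-- Jensen's bound for the number of roots that can be split off an entire function. -/
lemma card_mul_log_le {f g : ℂ → ℂ} (hg : Differentiable ℂ g) {s : Multiset ℂ} {r ρ : ℝ}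
    (hr : 0 < r) (hrρ : r < ρ) (hs : ∀ a ∈ s, ‖a‖ ≤ r) (hfg : ∀ z, f z = rootProd s z * g z)
    (hf0 : f 0 ≠ 0) :
    s.card * Real.log (ρ / r) + Real.log ‖f 0‖ ≤
      Real.circleAverage (fun z => Real.log ‖f z‖) 0 ρ := by
  have hρ : 0 < ρ := hr.trans hrρ
  have hg0 : g 0 ≠ 0 := fun h => hf0 (by rw [hfg, h, mul_zero])
  have hP0 : rootProd s 0 ≠ 0 := fun h => hf0 (by rw [hfg, h, zero_mul])
  have hB0 := reflProd_ne_zero hrρ hs (z := 0) (by simpa using hρ.le) hρ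
  -- Trading each root factor for its reflection keeps the modulus on `|z| = ρ` but raises the value
  -- at `0` from at most `r ^ N` to `ρ ^ N`; this gain counts the roots.
  have key := log_norm_le_circleAverage (h := fun z => reflProd ρ s z * g z)
    ((differentiable_reflProd ρ s).mul hg) (mul_ne_zero hB0 hg0) hρ
  have e : Real.circleAverage (fun z => Real.log ‖reflProd ρ s z * g z‖) 0 ρ =
      Real.circleAverage (fun z => Real.log ‖f z‖) 0 ρ := by
    refine Real.circleAverage_congr_sphere fun z hz => ?_
    rw [abs_of_pos hρ, mem_sphere_zero_iff_norm] at hz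
    simp only [hfg z, norm_mul, norm_reflProd_of_norm_eq hρ s hz]
  rw [e] at key
  refine le_trans ?_ key
  rw [norm_mul, norm_reflProd_zero hρ, Real.log_mul (by positivity) (norm_ne_zero_iff.2 hg0),
    Real.log_pow, hfg 0, norm_mul, Real.log_mul (norm_ne_zero_iff.2 hP0) (norm_ne_zero_iff.2 hg0),
    Real.log_div hρ.ne' hr.ne']
  have := Real.log_le_log (norm_pos_iff.2 hP0) (norm_rootProd_zero_le hs)
  rw [Real.log_pow] at this
  linarith

/-- All roots in a disc can be split off. -/
lemma exists_eq_rootProd_mul {f : ℂ → ℂ} (hf : Differentiable ℂ f) (hf0 : f 0 ≠ 0) {r : ℝ}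
    (hr : 0 < r) :
    ∃ (s : Multiset ℂ) (g : ℂ → ℂ), Differentiable ℂ g ∧ (∀ a ∈ s, ‖a‖ ≤ r) ∧
      (∀ z, f z = rootProd s z * g z) ∧ ∀ z, ‖z‖ ≤ r → g z ≠ 0 := by
  classical
  let Q : ℕ → Prop := fun n => ∃ (s : Multiset ℂ) (g : ℂ → ℂ), s.card = n ∧ Differentiable ℂ g ∧
    (∀ a ∈ s, ‖a‖ ≤ r) ∧ ∀ z, f z = rootProd s z * g z
  have hQ0 : Q 0 := ⟨0, f, rfl, hf, by simp, by simp [rootProd]⟩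
  -- Jensen's bound with `ρ = 2r` caps the number of roots, so a maximal factorization exists; a
  -- further zero of its cofactor would contradict maximality.
  obtain ⟨N, hN⟩ : ∃ N : ℕ, ∀ n, Q n → n ≤ N := by
    have hlog : 0 < Real.log (2 * r / r) := Real.log_pos (by rw [lt_div_iff₀ hr]; linarith)
    obtain ⟨N, hN⟩ := exists_nat_ge ((Real.circleAverage (fun z => Real.log ‖f z‖) 0 (2 * r) -
      Real.log ‖f 0‖) / Real.log (2 * r / r))
    refine ⟨N, ?_⟩
    rintro n ⟨s, g, hsn, hg, hs, hfg⟩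
    have := card_mul_log_le hg hr (by linarith : r < 2 * r) hs hfg hf0
    have h2 : (n : ℝ) ≤ N := by
      refine le_trans ?_ hN
      rw [le_div_iff₀ hlog, ← hsn]
      linarith
    exact_mod_cast h2
  obtain ⟨s, g, hsn, hg, hs, hfg⟩ := Nat.findGreatest_spec (P := Q) (Nat.zero_le N) hQ0
  refine ⟨s, g, hg, hs, hfg, fun a ha h0 => ?_⟩
  have hsucc : Q (Nat.findGreatest Q N + 1) := by
    refine ⟨a ::ₘ s, dslope g a, by simp [hsn], differentiable_dslope hg a, ?_, fun z => ?_⟩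
    · intro b hb
      rcases Multiset.mem_cons.1 hb with rfl | hb
      exacts [ha, hs b hb]
    · rw [hfg z, eq_sub_mul_dslope h0 z]
      simp only [rootProd, Multiset.map_cons, Multiset.prod_cons]
      ring
  exact absurd (Nat.le_findGreatest (hN _ hsucc) hsucc) (by omega)

/-! ### Lower bounds in terms of the zeros -/

/-- A lower bound of Harnack type for nonvanishing holomorphic functions. -/
lemma log_norm_ge_of_ne_zero {h : ℂ → ℂ} (hh : Differentiable ℂ h) {r M : ℝ} (hr : 0 < r)
    (hne : ∀ z, ‖z‖ ≤ r → h z ≠ 0) (hM : ∀ z, ‖z‖ ≤ r → Real.log ‖h z‖ ≤ M) {z : ℂ}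
    (hz : ‖z‖ < r) :
    Real.log ‖h 0‖ - 2 * (M - Real.log ‖h 0‖ + 1) * ‖z‖ / (r - ‖z‖) ≤ Real.log ‖h z‖ := by
  have hharm : InnerProductSpace.HarmonicOnNhd (fun z => Real.log ‖h z‖) (Metric.ball 0 r) :=
    fun w hw => (hh.analyticAt w).harmonicAt_log_norm
      (hne w (mem_ball_zero_iff.1 hw).le)
  obtain ⟨F, hF, hFre⟩ := hharm.exists_analyticOnNhd_ball_re_eq
  have h0 : (0 : ℂ) ∈ Metric.ball (0 : ℂ) r := Metric.mem_ball_self hr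
  have hM0 := hM 0 (by simpa using hr.le)
  have hzb : z ∈ Metric.ball (0 : ℂ) r := mem_ball_zero_iff.2 hz
  have hre : ∀ w ∈ Metric.ball (0 : ℂ) r, (F w).re = Real.log ‖h w‖ := fun w hw => hFre hw
  -- The extra `1` makes the bound on the real part strictly positive.
  have := Complex.borelCaratheodory_zero (f := fun w => F w - F 0) (R := r)
    (M := M - Real.log ‖h 0‖ + 1) (by linarith) (hF.differentiableOn.sub_const _)
    (fun w hw => by
      change (F w - F 0).re ≤ _
      rw [Complex.sub_re, hre w hw, hre 0 h0]
      have := hM w (mem_ball_zero_iff.1 hw).le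
      linarith) hr hzb (by simp)
  have h2 := (Complex.abs_re_le_norm (F z - F 0)).trans this
  rw [Complex.sub_re, hre z hzb, hre 0 h0] at h2
  have := neg_abs_le (Real.log ‖h z‖ - Real.log ‖h 0‖)
  linarith

lemma norm_reflProd_le {ρ : ℝ} (hρ : 0 < ρ) {s : Multiset ℂ} (hs : ∀ a ∈ s, ‖a‖ ≤ ρ) {z : ℂ}
    (hz : ‖z‖ ≤ ρ / 2) : ‖reflProd ρ s z‖ ≤ (3 / 2 * ρ) ^ s.card := by
  induction s using Multiset.induction_on with
  | empty => simp [reflProd]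
  | cons a s ih =>
    simp only [reflProd, Multiset.map_cons, Multiset.prod_cons, norm_mul, Multiset.card_cons]
      at ih ⊢
    have ha := hs a (Multiset.mem_cons_self a s)
    rw [pow_succ' (3 / 2 * ρ) s.card]
    refine mul_le_mul ?_ (ih fun b hb => hs b (Multiset.mem_cons_of_mem hb)) (norm_nonneg _)
      (by positivity)
    rw [norm_div, Complex.norm_real, Real.norm_eq_abs, abs_of_pos hρ, div_le_iff₀ hρ]
    refine (norm_sub_le _ _).trans ?_
    rw [norm_mul, RCLike.norm_conj, norm_pow, Complex.norm_real, Real.norm_eq_abs, abs_of_pos hρ]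
    nlinarith [norm_nonneg a, norm_nonneg z]

/-- Lower bound for an entire function on `|z| ≤ R` by a product over few roots, from its growth
on the circle `|z| = 2 R`. -/
theorem exists_rootProd_lower_bound {f : ℂ → ℂ} (hf : Differentiable ℂ f) (hf0 : f 0 ≠ 0)
    {R M A : ℝ} (hR : 0 < R) (hM : ∀ z, ‖z‖ = 2 * R → ‖f z‖ ≤ Real.exp M)
    (hA : Real.circleAverage (fun z => Real.log ‖f z‖) 0 (2 * R) ≤ A) :
    ∃ s : Multiset ℂ, s.card * Real.log (40 / 21) ≤ A - Real.log ‖f 0‖ ∧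
      ∀ z, ‖z‖ ≤ R → ‖rootProd s z‖ / (3 * R) ^ s.card *
        Real.exp (Real.log ‖f 0‖ - 40 * (M - Real.log ‖f 0‖ + 1)) ≤ ‖f z‖ := by
  -- The radius `21R/20` leaves a gap `R/20` beyond `|z| ≤ R`, whence the factor `40`, while the
  -- Jensen ratio `40/21` is still large enough for `log (40/21) > 2/π`.
  have hr : 0 < 21 / 20 * R := by positivity
  obtain ⟨s, g, hg, hs, hfg, hne⟩ := exists_eq_rootProd_mul hf hf0 hr
  have hrρ : 21 / 20 * R < 2 * R := by linarith
  have hρ : 0 < 2 * R := by positivity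
  refine ⟨s, ?_, ?_⟩
  · have := card_mul_log_le hg hr hrρ hs hfg hf0
    rw [show 2 * R / (21 / 20 * R) = 40 / 21 by field_simp; norm_num] at this
    linarith
  set h : ℂ → ℂ := fun z => reflProd (2 * R) s z * g z with hh
  have hhd : Differentiable ℂ h := (differentiable_reflProd _ s).mul hg
  have hhb : ∀ z, ‖z‖ ≤ 2 * R → ‖h z‖ ≤ Real.exp M := by
    intro z hz
    refine Complex.norm_le_of_forall_mem_frontier_norm_le (U := Metric.ball 0 (2 * R))
      Metric.isBounded_ball hhd.diffContOnCl ?_ ?_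
    · intro w hw
      rw [frontier_ball _ hρ.ne', mem_sphere_zero_iff_norm] at hw
      simp only [hh, norm_mul, norm_reflProd_of_norm_eq hρ s hw]
      rw [← norm_mul, ← hfg]
      exact hM w hw
    · rw [closure_ball _ hρ.ne']; simpa using hz
  have hhne : ∀ z, ‖z‖ ≤ 21 / 20 * R → h z ≠ 0 := fun z hz =>
    mul_ne_zero (reflProd_ne_zero hrρ hs (hz.trans hrρ.le) hρ) (hne z hz)
  have hhl : ∀ z, ‖z‖ ≤ 21 / 20 * R → Real.log ‖h z‖ ≤ M := fun z hz => by
    rw [Real.log_le_iff_le_exp (norm_pos_iff.2 (hhne z hz))]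
    exact hhb z (hz.trans hrρ.le)
  have h0 : Real.log ‖f 0‖ ≤ Real.log ‖h 0‖ := by
    refine Real.log_le_log (norm_pos_iff.2 hf0) ?_
    rw [hfg 0, hh]
    simp only [norm_mul, norm_reflProd_zero hρ]
    gcongr
    exact norm_rootProd_zero_le fun a ha => (hs a ha).trans hrρ.le
  intro z hz
  have hzr : ‖z‖ < 21 / 20 * R := by linarith
  have hlow := log_norm_ge_of_ne_zero hhd hr hhne hhl hzr
  have hM0 := hhl 0 (by simpa using hr.le)
  have hfrac : 2 * (M - Real.log ‖h 0‖ + 1) * ‖z‖ / (21 / 20 * R - ‖z‖) ≤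
      40 * (M - Real.log ‖f 0‖ + 1) := by
    rw [div_le_iff₀ (by linarith)]
    have e1 : 2 * (M - Real.log ‖h 0‖ + 1) * ‖z‖ ≤ 2 * (M - Real.log ‖f 0‖ + 1) * R := by
      gcongr
      · linarith
    have e2 : 40 * (M - Real.log ‖f 0‖ + 1) * (R / 20) ≤
        40 * (M - Real.log ‖f 0‖ + 1) * (21 / 20 * R - ‖z‖) :=
      mul_le_mul_of_nonneg_left (by linarith) (by linarith)
    linarith
  have hexp : Real.exp (Real.log ‖f 0‖ - 40 * (M - Real.log ‖f 0‖ + 1)) ≤ ‖h z‖ := by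
    rw [← Real.le_log_iff_exp_le (norm_pos_iff.2 (hhne z hzr.le))]
    linarith
  have hrefl : ‖reflProd (2 * R) s z‖ ≤ (3 * R) ^ s.card := by
    have := norm_reflProd_le hρ (fun a ha => (hs a ha).trans hrρ.le) (z := z) (by linarith)
    rwa [show 3 / 2 * (2 * R) = 3 * R by ring] at this
  have hP : 0 < (3 * R) ^ s.card := by positivity
  calc ‖rootProd s z‖ / (3 * R) ^ s.card *
        Real.exp (Real.log ‖f 0‖ - 40 * (M - Real.log ‖f 0‖ + 1))
      ≤ ‖rootProd s z‖ / (3 * R) ^ s.card * ‖h z‖ := by gcongr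
    _ = ‖rootProd s z‖ * ‖g z‖ * (‖reflProd (2 * R) s z‖ / (3 * R) ^ s.card) := by
        simp only [hh, norm_mul]; ring
    _ ≤ ‖rootProd s z‖ * ‖g z‖ * 1 := by
        gcongr
        rwa [div_le_one hP]
    _ = ‖f z‖ := by rw [mul_one, hfg z, norm_mul]

/-! ### Tails of `φ` and the Young dual -/

section Tail

variable {φ : ℝ → ℂ}

lemma measurableSet_le_abs (s : ℝ) : MeasurableSet {t : ℝ | s ≤ |t|} :=
  measurableSet_le measurable_const continuous_abs.measurable

lemma tail_pos (hφ : Integrable φ) (hsupp : ¬ HasEssCompactSupport φ) (s : ℝ) :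
    0 < ∫ t in {t : ℝ | s ≤ |t|}, ‖φ t‖ := by
  refine lt_of_le_of_ne (integral_nonneg fun t => norm_nonneg _) fun h => hsupp ?_
  have h2 := (setIntegral_eq_zero_iff_of_nonneg_ae
    (Eventually.of_forall fun t => norm_nonneg (φ t)) hφ.norm.integrableOn).1 h.symm
  rw [EventuallyEq, ae_restrict_iff' (measurableSet_le_abs s)] at h2
  refine ⟨Set.Icc (-s) s, isCompact_Icc, ?_⟩
  filter_upwards [h2] with t ht hts
  have : s ≤ |t| := by
    by_contra hlt
    push Not at hlt
    exact hts ⟨(abs_lt.1 hlt).1.le, (abs_lt.1 hlt).2.le⟩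
  simpa using ht this

lemma exp_neg_tailExponent (hφ : Integrable φ) (hsupp : ¬ HasEssCompactSupport φ) (s : ℝ) :
    Real.exp (-tailExponent φ s) = ∫ t in {t : ℝ | s ≤ |t|}, ‖φ t‖ := by
  rw [tailExponent, neg_neg, Real.exp_log (tail_pos hφ hsupp s)]

lemma tailExponent_mono (hφ : Integrable φ) (hsupp : ¬ HasEssCompactSupport φ) :
    Monotone (tailExponent φ) := by
  intro a b hab
  refine neg_le_neg (Real.log_le_log (tail_pos hφ hsupp b) ?_)
  refine setIntegral_mono_set hφ.norm.integrableOn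
    (Eventually.of_forall fun t => norm_nonneg _) (LE.le.eventuallyLE ?_)
  exact fun t (ht : b ≤ |t|) => hab.trans ht

end Tail

section Young

variable {p : ℝ → ℝ}

/-- The suprema defining the Young dual of `p` are finite. -/
def FiniteDual (p : ℝ → ℝ) : Prop :=
  ∀ s : ℝ, BddAbove (Set.range fun t : Set.Ici (0 : ℝ) => s * (t : ℝ) - p (t : ℝ))

lemma finiteDual_of_tendsto (hmono : Monotone p)
    (hp : Tendsto (fun s : ℝ => p s / s) atTop atTop) : FiniteDual p := by
  intro s
  obtain ⟨T, hT⟩ := eventually_atTop.1 ((hp.eventually_ge_atTop s).and (eventually_gt_atTop 0))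
  refine ⟨max 0 (|s| * |T| - p 0), ?_⟩
  rintro _ ⟨⟨t, ht⟩, rfl⟩
  have ht : 0 ≤ t := ht
  change s * t - p t ≤ _
  rcases le_total T t with h | h
  · obtain ⟨h1, h2⟩ := hT t h
    rw [le_div_iff₀ h2] at h1
    exact le_max_of_le_left (by linarith)
  · refine le_max_of_le_right ?_
    have h1 : s * t ≤ |s| * |T| :=
      mul_le_mul (le_abs_self s) (h.trans (le_abs_self T)) ht (abs_nonneg s)
    have := hmono ht
    linarith

lemma FiniteDual.le_youngDual (hP : FiniteDual p) (s : ℝ) {t : ℝ} (ht : 0 ≤ t) :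
    s * t - p t ≤ youngDual p s :=
  le_ciSup (hP s) ⟨t, ht⟩

lemma youngDual_le {s c : ℝ} (h : ∀ t, 0 ≤ t → s * t - p t ≤ c) : youngDual p s ≤ c :=
  ciSup_le fun t => h t t.2

lemma FiniteDual.monotone (hP : FiniteDual p) : Monotone (youngDual p) := fun a b hab =>
  youngDual_le fun t ht => (by gcongr : a * t - p t ≤ b * t - p t).trans (hP.le_youngDual b ht)

lemma FiniteDual.convexOn (hP : FiniteDual p) : ConvexOn ℝ Set.univ (youngDual p) := by
  refine ⟨convex_univ, fun x _ y _ a b ha hb hab => youngDual_le fun t ht => ?_⟩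
  have hx := mul_le_mul_of_nonneg_left (hP.le_youngDual x ht) ha
  have hy := mul_le_mul_of_nonneg_left (hP.le_youngDual y ht) hb
  simp only [smul_eq_mul]
  have : p t = a * p t + b * p t := by rw [← add_mul, hab, one_mul]
  linarith

lemma FiniteDual.continuous (hP : FiniteDual p) : Continuous (youngDual p) :=
  continuousOn_univ.1 (hP.convexOn.continuousOn isOpen_univ)

lemma FiniteDual.linear_le (hP : FiniteDual p) {t : ℝ} (ht : 0 ≤ t) (s : ℝ) :
    t * s - p t ≤ youngDual p s := by
  have := hP.le_youngDual s ht
  linarith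

end Young

/-! ### Growth, analyticity and nonvanishing of the transform -/

section Laplace

variable {φ : ℝ → ℂ}

lemma integral_mul_exp (x y : ℝ) :
    ∫ t in (0 : ℝ)..y, x * Real.exp (x * t) = Real.exp (x * y) - 1 := by
  have h : ∀ t ∈ Set.uIcc 0 y, HasDerivAt (fun t => Real.exp (x * t)) (x * Real.exp (x * t)) t := by
    intro t _
    have := ((hasDerivAt_id t).const_mul x).exp
    simpa [mul_comm] using this
  rw [intervalIntegral.integral_eq_sub_of_hasDerivAt h]
  · simp
  · exact Continuous.intervalIntegrable (by fun_prop) _ _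

/-- Layer cake for the measure `|φ| dt`, whose tails are `exp (-p(s))`. Evaluating the dual at `x +
1` rather than `x` leaves a spare factor `exp (-s)`, which makes the integral over `s` converge. -/
lemma lintegral_exp_mul_le (hφ : Integrable φ) (hsupp : ¬ HasEssCompactSupport φ)
    (hP : FiniteDual (tailExponent φ)) {x : ℝ} (hx : 0 ≤ x) :
    ∫⁻ t : ℝ, ‖φ t‖ₑ * ENNReal.ofReal (Real.exp (x * |t|)) ≤
      ENNReal.ofReal ((1 + x) * Real.exp (youngDual (tailExponent φ) (x + 1))) := by
  set P := youngDual (tailExponent φ) (x + 1) with hPdef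
  have hae : AEMeasurable (fun t => ‖φ t‖ₑ) volume := hφ.1.enorm
  set μ := volume.withDensity fun t => ‖φ t‖ₑ with hμ
  have hμs : ∀ s : ℝ, μ {t | s ≤ |t|} = ENNReal.ofReal (Real.exp (-tailExponent φ s)) := by
    intro s
    rw [hμ, withDensity_apply _ (measurableSet_le_abs s), exp_neg_tailExponent hφ hsupp,
      ofReal_integral_norm_eq_lintegral_enorm hφ.integrableOn]
  have hle : ∀ s : ℝ, 0 ≤ s → Real.exp (-tailExponent φ s) ≤
      Real.exp P * Real.exp (-(x * s)) * Real.exp (-s) := by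
    intro s hs
    rw [← Real.exp_add, ← Real.exp_add, Real.exp_le_exp]
    have := hP.le_youngDual (x + 1) hs
    linarith
  have hcake := lintegral_comp_eq_lintegral_meas_le_mul μ (f := fun t : ℝ => |t|)
    (g := fun s => x * Real.exp (x * s)) (Eventually.of_forall fun t => abs_nonneg t)
    continuous_abs.measurable.aemeasurable
    (fun t _ => Continuous.intervalIntegrable (by fun_prop) _ _)
    (Eventually.of_forall fun t => by positivity)
  simp only [integral_mul_exp] at hcake
  have h1 : ∫⁻ t, ENNReal.ofReal (Real.exp (x * |t|) - 1) ∂μ ≤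
      ENNReal.ofReal (x * Real.exp P) := by
    rw [hcake]
    calc ∫⁻ s in Set.Ioi (0 : ℝ), μ {t | s ≤ |t|} * ENNReal.ofReal (x * Real.exp (x * s))
        ≤ ∫⁻ s in Set.Ioi (0 : ℝ), ENNReal.ofReal (x * Real.exp P) *
            ENNReal.ofReal (Real.exp (-s)) := by
          refine setLIntegral_mono' measurableSet_Ioi fun s hs => ?_
          rw [hμs, ← ENNReal.ofReal_mul (Real.exp_pos _).le, ← ENNReal.ofReal_mul (by positivity)]
          refine ENNReal.ofReal_le_ofReal ?_
          calc Real.exp (-tailExponent φ s) * (x * Real.exp (x * s))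
              ≤ Real.exp P * Real.exp (-(x * s)) * Real.exp (-s) * (x * Real.exp (x * s)) := by
                gcongr; exact hle s (le_of_lt hs)
            _ = x * Real.exp P * Real.exp (-s) * (Real.exp (-(x * s)) * Real.exp (x * s)) := by
                ring
            _ = x * Real.exp P * Real.exp (-s) := by rw [← Real.exp_add]; simp
      _ = ENNReal.ofReal (x * Real.exp P) := by
          rw [lintegral_const_mul _ (by fun_prop), ← ofReal_integral_eq_lintegral_ofReal
            (integrableOn_exp_neg_Ioi 0) (Eventually.of_forall fun t => (Real.exp_pos _).le),
            integral_exp_neg_Ioi_zero, ENNReal.ofReal_one, mul_one]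
  have h2 : ∫⁻ _ : ℝ, 1 ∂μ ≤ ENNReal.ofReal (Real.exp P) := by
    have : (Set.univ : Set ℝ) = {t : ℝ | 0 ≤ |t|} := by ext; simp
    rw [lintegral_one, this, hμs]
    refine ENNReal.ofReal_le_ofReal ((hle 0 le_rfl).trans ?_)
    simp
  calc ∫⁻ t : ℝ, ‖φ t‖ₑ * ENNReal.ofReal (Real.exp (x * |t|))
      = ∫⁻ t, ENNReal.ofReal (Real.exp (x * |t|)) ∂μ := by
        rw [hμ, lintegral_withDensity_eq_lintegral_mul₀ hae (by fun_prop)]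
        rfl
    _ = ∫⁻ t, (1 + ENNReal.ofReal (Real.exp (x * |t|) - 1)) ∂μ := by
        refine lintegral_congr fun t => ?_
        have : 1 ≤ Real.exp (x * |t|) := Real.one_le_exp (by positivity)
        rw [← ENNReal.ofReal_one, ← ENNReal.ofReal_add zero_le_one (by linarith)]
        congr 1; ring
    _ = ∫⁻ _, 1 ∂μ + ∫⁻ t, ENNReal.ofReal (Real.exp (x * |t|) - 1) ∂μ :=
        lintegral_add_left measurable_const _
    _ ≤ ENNReal.ofReal (Real.exp P) + ENNReal.ofReal (x * Real.exp P) := add_le_add h2 h1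
    _ = ENNReal.ofReal ((1 + x) * Real.exp P) := by
        rw [← ENNReal.ofReal_add (by positivity) (by positivity)]
        congr 1; ring

lemma integrable_norm_mul_exp (hφ : Integrable φ) (hsupp : ¬ HasEssCompactSupport φ)
    (hP : FiniteDual (tailExponent φ)) {x : ℝ} (hx : 0 ≤ x) :
    Integrable fun t : ℝ => ‖φ t‖ * Real.exp (x * |t|) := by
  refine ⟨hφ.1.norm.mul (by fun_prop), ?_⟩
  refine lt_of_le_of_lt ?_ ((lintegral_exp_mul_le hφ hsupp hP hx).trans_lt ENNReal.ofReal_lt_top)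
  refine lintegral_mono fun t => ?_
  rw [enorm_mul, enorm_norm, Real.enorm_eq_ofReal (Real.exp_pos _).le]

lemma integral_norm_mul_exp_le (hφ : Integrable φ) (hsupp : ¬ HasEssCompactSupport φ)
    (hP : FiniteDual (tailExponent φ)) {x : ℝ} (hx : 0 ≤ x) :
    ∫ t : ℝ, ‖φ t‖ * Real.exp (x * |t|) ≤
      (1 + x) * Real.exp (youngDual (tailExponent φ) (x + 1)) := by
  rw [integral_eq_lintegral_of_nonneg_ae (Eventually.of_forall fun t => by positivity)
    (integrable_norm_mul_exp hφ hsupp hP hx).1]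
  refine ENNReal.toReal_le_of_le_ofReal (by positivity) ?_
  refine le_trans (lintegral_mono fun t => ?_) (lintegral_exp_mul_le hφ hsupp hP hx)
  rw [ENNReal.ofReal_mul (norm_nonneg _), ofReal_norm]

lemma norm_exp_mul_le (z : ℂ) (t : ℝ) :
    ‖Complex.exp (z * t)‖ ≤ Real.exp (|z.re| * |t|) := by
  rw [Complex.norm_exp, Complex.re_mul_ofReal, Real.exp_le_exp, ← abs_mul]
  exact le_abs_self _

lemma norm_laplace_le (hφ : Integrable φ) (hsupp : ¬ HasEssCompactSupport φ)
    (hP : FiniteDual (tailExponent φ)) (z : ℂ) :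
    ‖laplace φ z‖ ≤ (1 + |z.re|) * Real.exp (youngDual (tailExponent φ) (|z.re| + 1)) := by
  refine le_trans (norm_integral_le_of_norm_le
    (integrable_norm_mul_exp hφ hsupp hP (abs_nonneg z.re)) (Eventually.of_forall fun t => ?_))
    (integral_norm_mul_exp_le hφ hsupp hP (abs_nonneg z.re))
  rw [norm_mul, mul_comm]
  gcongr
  exact norm_exp_mul_le z t

lemma differentiable_laplace (hφ : Integrable φ) (hsupp : ¬ HasEssCompactSupport φ)
    (hP : FiniteDual (tailExponent φ)) : Differentiable ℂ (laplace φ) := by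
  intro z₀
  have hmeas : ∀ z : ℂ, AEStronglyMeasurable (fun t : ℝ => Complex.exp (z * t) * φ t) volume :=
    fun z => AEStronglyMeasurable.mul (by fun_prop) hφ.1
  refine (hasDerivAt_integral_of_dominated_loc_of_deriv_le (μ := volume)
    (F := fun z (t : ℝ) => Complex.exp (z * t) * φ t)
    (F' := fun z (t : ℝ) => (t : ℂ) * Complex.exp (z * t) * φ t) (x₀ := z₀)
    -- One unit in `+ 2` covers the variation of `Re z` on the unit ball, the other the factor `|t|
    -- ≤ exp |t|`.
    (bound := fun t => ‖φ t‖ * Real.exp ((|z₀.re| + 2) * |t|))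
    (Metric.ball_mem_nhds z₀ one_pos) (Eventually.of_forall hmeas) ?_ ?_ ?_
    (integrable_norm_mul_exp hφ hsupp hP (by positivity)) ?_).2.differentiableAt
  · refine (integrable_norm_mul_exp hφ hsupp hP (abs_nonneg z₀.re)).mono' (hmeas z₀)
      (Eventually.of_forall fun t => ?_)
    rw [norm_mul, mul_comm]
    gcongr
    exact norm_exp_mul_le z₀ t
  · exact AEStronglyMeasurable.mul (by fun_prop) hφ.1
  · refine Eventually.of_forall fun t z hz => ?_
    have hre : |z.re| ≤ |z₀.re| + 1 := by
      have h1 : |(z - z₀).re| ≤ 1 := (Complex.abs_re_le_norm _).trans (mem_ball_iff_norm.1 hz).le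
      rw [Complex.sub_re] at h1
      have := abs_sub_abs_le_abs_sub z.re z₀.re
      linarith
    have ht : |t| ≤ Real.exp |t| := by linarith [Real.add_one_le_exp |t|]
    rw [norm_mul, norm_mul, Complex.norm_real, Real.norm_eq_abs, mul_comm]
    gcongr
    calc |t| * ‖Complex.exp (z * t)‖ ≤ Real.exp |t| * Real.exp ((|z₀.re| + 1) * |t|) := by
          gcongr
          refine (norm_exp_mul_le z t).trans (Real.exp_le_exp.2 ?_)
          gcongr
      _ = Real.exp ((|z₀.re| + 2) * |t|) := by rw [← Real.exp_add]; congr 1; ring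
  · refine Eventually.of_forall fun t z _ => ?_
    have h := (((hasDerivAt_id z).mul_const (t : ℂ)).cexp).mul_const (φ t)
    simpa [mul_comm] using h

/-- A real integrable function whose Fourier transform vanishes is zero. -/
lemma ae_eq_zero_of_fourier_real {ψ : ℝ → ℝ} (hψ : Integrable ψ)
    (h : ∀ ξ : ℝ, ∫ t : ℝ, Complex.exp (ξ * t * Complex.I) * (ψ t : ℂ) = 0) : ψ =ᵐ[volume] 0 := by
  have hfin : ∀ {f : ℝ → ℝ}, Integrable f →
      IsFiniteMeasure (volume.withDensity fun t => ENNReal.ofReal (f t)) :=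
    fun hf => isFiniteMeasure_withDensity_ofReal hf.2
  have hf1 := hfin hψ
  have hf2 := hfin hψ.neg
  have hint : ∀ ξ : ℝ, ∀ {f : ℝ → ℝ}, Integrable f →
      Integrable fun t : ℝ => ((max (f t) 0 : ℝ) : ℂ) * Complex.exp (ξ * t * Complex.I) := by
    intro ξ f hf
    refine (hf.pos_part.ofReal (𝕜 := ℂ)).mul_bdd (c := 1) (by fun_prop)
      (Eventually.of_forall fun t => ?_)
    rw [← Complex.ofReal_mul, Complex.norm_exp_ofReal_mul_I]
  have hchar : ∀ {f : ℝ → ℝ}, Integrable f → ∀ ξ : ℝ,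
      charFun (volume.withDensity fun t => ENNReal.ofReal (f t)) ξ =
        ∫ t : ℝ, ((max (f t) 0 : ℝ) : ℂ) * Complex.exp (ξ * t * Complex.I) := by
    intro f hf ξ
    rw [charFun_apply_real, integral_withDensity_eq_integral_toReal_smul₀
      hf.1.aemeasurable.ennreal_ofReal (Eventually.of_forall fun t => ENNReal.ofReal_lt_top)]
    refine integral_congr_ae (Eventually.of_forall fun t => ?_)
    simp [ENNReal.toReal_ofReal']
  -- The positive and negative parts of `ψ` are densities of finite measures with the same
  -- characteristic function.
  have heq : volume.withDensity (fun t => ENNReal.ofReal (ψ t)) =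
      volume.withDensity (fun t => ENNReal.ofReal ((-ψ) t)) := by
    refine Measure.ext_of_charFun (funext fun ξ => ?_)
    rw [hchar hψ, hchar hψ.neg, ← sub_eq_zero, ← integral_sub (hint ξ hψ) (hint ξ hψ.neg), ← h ξ]
    refine integral_congr_ae (Eventually.of_forall fun t => ?_)
    have : max (ψ t) 0 - max ((-ψ) t) 0 = ψ t := by
      rcases le_total (ψ t) 0 with h | h <;> simp [h]
    simp only
    rw [← sub_mul, ← Complex.ofReal_sub, this, mul_comm]
  rw [withDensity_eq_iff hψ.1.aemeasurable.ennreal_ofReal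
    hψ.neg.1.aemeasurable.ennreal_ofReal hψ.lintegral_lt_top.ne] at heq
  filter_upwards [heq] with t ht
  rcases le_total (ψ t) 0 with h | h
  · rw [ENNReal.ofReal_of_nonpos h, eq_comm, ENNReal.ofReal_eq_zero] at ht
    simp only [Pi.neg_apply, Pi.zero_apply] at ht ⊢
    linarith
  · have h2 : (-ψ) t ≤ 0 := by simpa using h
    rw [ENNReal.ofReal_of_nonpos h2, ENNReal.ofReal_eq_zero] at ht
    exact le_antisymm ht h

/-- Vanishing on the imaginary axis means a vanishing Fourier transform. Conjugation passes this to
`conj φ`, hence to the real and imaginary parts, so `φ = 0` almost everywhere, which is a compact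
support. -/
lemma exists_laplace_ne_zero (hφ : Integrable φ) (hsupp : ¬ HasEssCompactSupport φ) :
    ∃ w, laplace φ w ≠ 0 := by
  by_contra! hall
  refine hsupp ⟨∅, isCompact_empty, ?_⟩
  have hf : ∀ ξ : ℝ, ∫ t : ℝ, Complex.exp (ξ * t * Complex.I) * φ t = 0 := fun ξ => by
    rw [← hall (ξ * Complex.I), laplace]
    congr 1; funext t; congr 2; ring
  have hb : ∀ ξ : ℝ, ∀ {g : ℝ → ℂ}, Integrable g →
      Integrable fun t : ℝ => Complex.exp (ξ * t * Complex.I) * g t := by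
    intro ξ g hg
    refine hg.bdd_mul (c := 1) (by fun_prop) (Eventually.of_forall fun t => ?_)
    rw [← Complex.ofReal_mul, Complex.norm_exp_ofReal_mul_I]
  have hcint : Integrable fun t => (starRingEnd ℂ) (φ t) :=
    Complex.conjCLE.toContinuousLinearMap.integrable_comp hφ
  have hc : ∀ ξ : ℝ, ∫ t : ℝ, Complex.exp (ξ * t * Complex.I) * (starRingEnd ℂ) (φ t) = 0 := by
    intro ξ
    have := congrArg (starRingEnd ℂ) (hf (-ξ))
    rw [← integral_conj, map_zero] at this
    rw [← this]
    congr 1; funext t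
    rw [map_mul, ← Complex.exp_conj]
    simp
  have hre := ae_eq_zero_of_fourier_real (ψ := fun t => (φ t).re) hφ.re fun ξ => by
    have : ∀ t : ℝ, Complex.exp (ξ * t * Complex.I) * ((φ t).re : ℂ) =
        1 / 2 * (Complex.exp (ξ * t * Complex.I) * φ t +
          Complex.exp (ξ * t * Complex.I) * (starRingEnd ℂ) (φ t)) := fun t => by
      rw [Complex.re_eq_add_conj]; ring
    simp_rw [this]
    rw [integral_const_mul, integral_add (hb ξ hφ) (hb ξ hcint), hf, hc]
    simp
  have him := ae_eq_zero_of_fourier_real (ψ := fun t => (φ t).im) hφ.im fun ξ => by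
    have : ∀ t : ℝ, Complex.exp (ξ * t * Complex.I) * ((φ t).im : ℂ) =
        1 / (2 * Complex.I) * (Complex.exp (ξ * t * Complex.I) * φ t -
          Complex.exp (ξ * t * Complex.I) * (starRingEnd ℂ) (φ t)) := fun t => by
      rw [Complex.im_eq_sub_conj]; ring
    simp_rw [this]
    rw [integral_const_mul, integral_sub (hb ξ hφ) (hb ξ hcint), hf, hc]
    simp
  filter_upwards [hre, him] with t h1 h2 _
  exact Complex.ext h1 h2

end Laplace

/-! ### Area of the set where a polynomial is small -/

lemma lintegral_posLog_le (a : ℂ) {r : ℝ} (hr : 0 < r) :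
    ∫⁻ z : ℂ, ENNReal.ofReal (Real.posLog (r / ‖z - a‖)) ≤ ENNReal.ofReal (Real.pi * r ^ 2) := by
  rw [lintegral_eq_lintegral_meas_le volume (Eventually.of_forall fun z => Real.posLog_nonneg)
    (Measurable.aemeasurable (by unfold Real.posLog; fun_prop))]
  calc ∫⁻ t in Set.Ioi (0 : ℝ), volume {z : ℂ | t ≤ Real.posLog (r / ‖z - a‖)}
      ≤ ∫⁻ t in Set.Ioi (0 : ℝ), ENNReal.ofReal (Real.pi * r ^ 2) *
          ENNReal.ofReal (Real.exp (-t)) := by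
        refine setLIntegral_mono' measurableSet_Ioi fun t (ht : 0 < t) => ?_
        have hsub : {z : ℂ | t ≤ Real.posLog (r / ‖z - a‖)} ⊆
            Metric.closedBall a (r * Real.exp (-t)) := by
          intro z (hz : t ≤ Real.posLog (r / ‖z - a‖))
          rw [mem_closedBall_iff_norm]
          rcases (norm_nonneg (z - a)).eq_or_lt with h0 | h0
          · rw [← h0]; positivity
          have hlog : t ≤ Real.log (r / ‖z - a‖) := by
            rw [Real.posLog_def] at hz
            rcases le_max_iff.1 hz with h | h
            · exact absurd h (not_le.2 ht)
            · exact h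
          rw [Real.le_log_iff_exp_le (by positivity), le_div_iff₀ h0] at hlog
          rw [Real.exp_neg, ← div_eq_mul_inv, le_div_iff₀ (Real.exp_pos t)]
          linarith
        refine (measure_mono hsub).trans ?_
        rw [Complex.volume_closedBall, ← ENNReal.ofReal_pow (by positivity),
          ← ENNReal.ofReal_coe_nnreal, ← ENNReal.ofReal_mul (by positivity),
          ← ENNReal.ofReal_mul (by positivity)]
        refine ENNReal.ofReal_le_ofReal ?_
        have h1 : Real.exp (-t) ≤ 1 := Real.exp_le_one_iff.2 (by linarith)
        -- The loss of a factor two in the integral is harmless.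
        have h2 : Real.exp (-t) ^ 2 ≤ Real.exp (-t) := by nlinarith [Real.exp_pos (-t)]
        calc (r * Real.exp (-t)) ^ 2 * Real.pi = Real.pi * r ^ 2 * Real.exp (-t) ^ 2 := by ring
          _ ≤ Real.pi * r ^ 2 * Real.exp (-t) := by gcongr
    _ = ENNReal.ofReal (Real.pi * r ^ 2) := by
        rw [lintegral_const_mul _ (by fun_prop), ← ofReal_integral_eq_lintegral_ofReal
          (integrableOn_exp_neg_Ioi 0) (Eventually.of_forall fun t => (Real.exp_pos _).le),
          integral_exp_neg_Ioi_zero, ENNReal.ofReal_one, mul_one]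

/-- The logarithmic potential `∑ log⁺ (r / |z - a|)` of a multiset of points. -/
noncomputable def potential (r : ℝ) (s : Multiset ℂ) (z : ℂ) : ℝ :=
  (s.map fun a => Real.posLog (r / ‖z - a‖)).sum

lemma potential_cons (r : ℝ) (a : ℂ) (s : Multiset ℂ) (z : ℂ) :
    potential r (a ::ₘ s) z = Real.posLog (r / ‖z - a‖) + potential r s z := by
  simp [potential]

lemma measurable_potential (r : ℝ) (s : Multiset ℂ) : Measurable (potential r s) := by
  induction s using Multiset.induction_on with
  | empty => exact measurable_const
  | cons a s ih =>
    have h : Measurable fun z : ℂ => Real.posLog (r / ‖z - a‖) := by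
      unfold Real.posLog; fun_prop
    rw [show potential r (a ::ₘ s) = fun z => Real.posLog (r / ‖z - a‖) + potential r s z from
      funext (potential_cons r a s)]
    exact h.add ih

lemma lintegral_potential_le {r : ℝ} (hr : 0 < r) (s : Multiset ℂ) :
    ∫⁻ z : ℂ, ENNReal.ofReal (potential r s z) ≤
      ENNReal.ofReal (s.card * (Real.pi * r ^ 2)) := by
  induction s using Multiset.induction_on with
  | empty => simp [potential]
  | cons a s ih =>
    calc ∫⁻ z : ℂ, ENNReal.ofReal (potential r (a ::ₘ s) z)
        ≤ ∫⁻ z : ℂ, (ENNReal.ofReal (potential r s z) +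
            ENNReal.ofReal (Real.posLog (r / ‖z - a‖))) := by
          refine lintegral_mono fun z => ?_
          simp only [potential_cons]
          rw [add_comm]
          exact ENNReal.ofReal_add_le
      _ = (∫⁻ z : ℂ, ENNReal.ofReal (potential r s z)) +
            ∫⁻ z : ℂ, ENNReal.ofReal (Real.posLog (r / ‖z - a‖)) :=
          lintegral_add_left (measurable_potential r s).ennreal_ofReal _
      _ ≤ ENNReal.ofReal (s.card * (Real.pi * r ^ 2)) + ENNReal.ofReal (Real.pi * r ^ 2) :=
          add_le_add ih (lintegral_posLog_le a hr)
      _ = _ := by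
          rw [← ENNReal.ofReal_add (by positivity) (by positivity), Multiset.card_cons]
          congr 1; push_cast; ring

/-- Roots must be excluded: since `r / 0 = 0`, the potential omits the infinite contribution of a
root at that root itself. -/
lemma exp_neg_potential_le {r : ℝ} (hr : 0 < r) {s : Multiset ℂ} {z : ℂ} (hz : z ∉ s) :
    Real.exp (-potential r s z) ≤ ‖rootProd s z‖ / r ^ s.card := by
  induction s using Multiset.induction_on with
  | empty => simp [potential, rootProd]
  | cons a s ih =>
    rw [Multiset.mem_cons, not_or] at hz
    have hpos : 0 < ‖z - a‖ := norm_pos_iff.2 (sub_ne_zero.2 hz.1)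
    have h1 : Real.exp (-Real.posLog (r / ‖z - a‖)) ≤ ‖z - a‖ / r := by
      rw [← Real.le_log_iff_exp_le (by positivity), ← inv_div r, Real.log_inv]
      exact neg_le_neg (by rw [Real.posLog_def]; exact le_max_right _ _)
    rw [potential_cons, neg_add, Real.exp_add, Multiset.card_cons, pow_succ' r s.card]
    calc Real.exp (-Real.posLog (r / ‖z - a‖)) * Real.exp (-potential r s z)
        ≤ ‖z - a‖ / r * (‖rootProd s z‖ / r ^ s.card) :=
          mul_le_mul h1 (ih hz.2) (Real.exp_pos _).le (by positivity)
      _ = ‖rootProd (a ::ₘ s) z‖ / (r * r ^ s.card) := by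
          simp only [rootProd, Multiset.map_cons, Multiset.prod_cons, norm_mul]
          field_simp

/-- The set where a monic polynomial is small has small area. -/
lemma volume_rootProd_le {r B : ℝ} (hr : 0 < r) (hB : 0 < B) (s : Multiset ℂ) :
    volume {z : ℂ | ‖rootProd s z‖ / r ^ s.card ≤ Real.exp (-B)} ≤
      ENNReal.ofReal (s.card * (Real.pi * r ^ 2) / B) := by
  -- Outside the null set of roots the potential is at least `B`, and Markov's inequality applies.
  have hsub : {z : ℂ | ‖rootProd s z‖ / r ^ s.card ≤ Real.exp (-B)} ⊆
      {z | z ∈ s.toFinset} ∪ {z | ENNReal.ofReal B ≤ ENNReal.ofReal (potential r s z)} := by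
    intro z hz
    by_cases hzs : z ∈ s
    · exact Or.inl (Multiset.mem_toFinset.2 hzs)
    · refine Or.inr (ENNReal.ofReal_le_ofReal ?_)
      have := (exp_neg_potential_le hr hzs).trans hz
      rw [Real.exp_le_exp] at this
      linarith
  refine (measure_mono hsub).trans ((measure_union_le _ _).trans ?_)
  have h0 : volume {z : ℂ | z ∈ s.toFinset} = 0 := s.toFinset.finite_toSet.measure_zero _
  rw [h0, zero_add, ENNReal.ofReal_div_of_pos hB]
  refine (meas_ge_le_lintegral_div (measurable_potential r s).ennreal_ofReal.aemeasurable
    (by simpa using hB) ENNReal.ofReal_ne_top).trans ?_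
  gcongr
  exact lintegral_potential_le hr s

/-! ### The mean of `|Re z|` on a circle -/

lemma integral_abs_cos : ∫ θ in (0 : ℝ)..(2 * Real.pi), |Real.cos θ| = 4 := by
  have hpi := Real.pi_pos
  have hper : Function.Periodic (fun θ => |Real.cos θ|) Real.pi := fun θ => by
    simp [Real.cos_add_pi]
  have hi : ∀ a b : ℝ, IntervalIntegrable (fun θ => |Real.cos θ|) volume a b :=
    fun a b => Continuous.intervalIntegrable (by fun_prop) _ _
  have hhalf : ∫ θ in (-(Real.pi / 2))..(Real.pi / 2), |Real.cos θ| = 2 := by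
    have : ∫ θ in (-(Real.pi / 2))..(Real.pi / 2), |Real.cos θ| =
        ∫ θ in (-(Real.pi / 2))..(Real.pi / 2), Real.cos θ := by
      refine intervalIntegral.integral_congr fun θ hθ => ?_
      rw [Set.uIcc_of_le (by linarith)] at hθ
      exact abs_of_nonneg (Real.cos_nonneg_of_mem_Icc hθ)
    rw [this, integral_cos, Real.sin_neg, Real.sin_pi_div_two]
    norm_num
  have h1 : ∀ t : ℝ, ∫ θ in t..(t + Real.pi), |Real.cos θ| = 2 := fun t => by
    rw [hper.intervalIntegral_add_eq t (-(Real.pi / 2)), show -(Real.pi / 2) + Real.pi = Real.pi / 2 by ring, hhalf]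
  rw [← intervalIntegral.integral_add_adjacent_intervals (hi 0 (0 + Real.pi))
    (hi (0 + Real.pi) (2 * Real.pi)), h1,
    show 2 * Real.pi = (0 + Real.pi) + Real.pi by ring, h1]
  norm_num

lemma circleAverage_add_mul_abs_re (a b : ℝ) {ρ : ℝ} (hρ : 0 ≤ ρ) :
    Real.circleAverage (fun z => a + b * |z.re|) 0 ρ = a + b * (ρ * (2 / Real.pi)) := by
  have hpi := Real.pi_pos
  have h : ∀ θ : ℝ, a + b * |(circleMap 0 ρ θ).re| = a + b * ρ * |Real.cos θ| := fun θ => by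
    rw [circleMap_zero_re, abs_mul, abs_of_nonneg hρ]
    ring
  rw [Real.circleAverage_def]
  simp_rw [h]
  rw [intervalIntegral.integral_add (by simp)
    (Continuous.intervalIntegrable (by fun_prop) _ _), intervalIntegral.integral_const_mul,
    integral_abs_cos]
  simp only [intervalIntegral.integral_const, smul_eq_mul]
  field_simp
  ring

/-! ### The equation for the radius -/

section Radius

variable {P : ℝ → ℝ} {q : ℝ}

/-- The factor `(q + 1/2) log R + log (15 e³)`. -/
noncomputable def logFactor (q R : ℝ) : ℝ :=
  (q + 1 / 2) * Real.log R + Real.log (15 * Real.exp 3)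

/-- The factor `1 + log (2 R) + P (2 R + 1)`. -/
noncomputable def growthFactor (P : ℝ → ℝ) (R : ℝ) : ℝ :=
  1 + Real.log (2 * R) + P (2 * R + 1)

lemma one_le_log_const : 1 ≤ Real.log (15 * Real.exp 3) := by
  rw [Real.log_mul (by norm_num) (Real.exp_pos 3).ne', Real.log_exp]
  have : 0 ≤ Real.log 15 := Real.log_nonneg (by norm_num)
  linarith

lemma one_le_logFactor (hq : 1 / 2 < q) {R : ℝ} (hR : 1 ≤ R) : 1 ≤ logFactor q R := by
  have h1 := Real.log_nonneg hR
  have := mul_nonneg (by linarith : 0 ≤ q + 1 / 2) h1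
  unfold logFactor
  linarith [one_le_log_const]

lemma logFactor_lt (hq : 1 / 2 < q) {a b : ℝ} (ha : 0 < a) (hab : a < b) :
    logFactor q a < logFactor q b := by
  have := mul_lt_mul_of_pos_left (Real.log_lt_log ha hab) (by linarith : 0 < q + 1 / 2)
  unfold logFactor
  linarith

lemma growthFactor_lt (hP : Monotone P) {a b : ℝ} (ha : 0 < a) (hab : a < b) :
    growthFactor P a < growthFactor P b := by
  have h1 : Real.log (2 * a) < Real.log (2 * b) :=
    Real.log_lt_log (by positivity) (by linarith)
  have h2 : P (2 * a + 1) ≤ P (2 * b + 1) := hP (by linarith)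
  unfold growthFactor
  linarith

lemma tendsto_growthFactor {c : ℝ} (hc : ∀ s, s - c ≤ P s) :
    Tendsto (growthFactor P) atTop atTop := by
  refine tendsto_atTop_mono' _ ?_ (tendsto_atTop_add_const_right atTop (-c) tendsto_id)
  filter_upwards [eventually_ge_atTop 1] with R hR
  have h1 : 0 ≤ Real.log (2 * R) := Real.log_nonneg (by linarith)
  have := hc (2 * R + 1)
  unfold growthFactor
  simp only [id]
  linarith

/-- The growth factor may be negative for small radii, so monotonicity is claimed only from a point
where the product is positive; from there both factors are positive and increase. -/
lemma radius_product_lt (hq : 1 / 2 < q) (hP : Monotone P) {a b : ℝ} (ha : 1 ≤ a) (hab : a < b)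
    (hpos : 0 < logFactor q a * growthFactor P a) :
    logFactor q a * growthFactor P a < logFactor q b * growthFactor P b := by
  have h1 := one_le_logFactor hq ha
  have hL : 0 < growthFactor P a := (pos_iff_pos_of_mul_pos hpos).1 (by linarith)
  exact mul_lt_mul'' (logFactor_lt hq (by linarith) hab) (growthFactor_lt hP (by linarith) hab)
    (by linarith) hL.le

lemma tendsto_radius_product (hq : 1 / 2 < q) {c : ℝ} (hc : ∀ s, s - c ≤ P s) :
    Tendsto (fun R => logFactor q R * growthFactor P R) atTop atTop := by
  refine tendsto_atTop_mono' _ ?_ (tendsto_growthFactor hc)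
  filter_upwards [eventually_ge_atTop 1, (tendsto_growthFactor hc).eventually_ge_atTop 0]
    with R hR hL
  exact le_mul_of_one_le_left hL (one_le_logFactor hq hR)

lemma continuousOn_radius_product (hcont : Continuous P) :
    ContinuousOn (fun R => logFactor q R * growthFactor P R) (Set.Ici 1) := by
  unfold logFactor growthFactor
  intro R hR
  have : (1 : ℝ) ≤ R := hR
  have h1 : R ≠ 0 := by linarith
  have h2 : 2 * R ≠ 0 := by linarith
  exact ContinuousAt.continuousWithinAt (by fun_prop (disch := assumption))

lemma existsUnique_radius (hq : 1 / 2 < q) (hP : Monotone P) (hcont : Continuous P) {c : ℝ}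
    (hc : ∀ s, s - c ≤ P s) {y : ℝ} (hy : 0 < y) (hy1 : logFactor q 1 * growthFactor P 1 ≤ y) :
    ∃! R : ℝ, 1 ≤ R ∧ logFactor q R * growthFactor P R = y := by
  obtain ⟨b, hb1, hb⟩ := ((eventually_ge_atTop 1).and
    ((tendsto_radius_product hq hc).eventually_ge_atTop y)).exists
  obtain ⟨R, hR, hRy⟩ := intermediate_value_Icc hb1
    ((continuousOn_radius_product (q := q) hcont).mono Set.Icc_subset_Ici_self) ⟨hy1, hb⟩
  refine ⟨R, ⟨hR.1, hRy⟩, ?_⟩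
  rintro R' ⟨hR', hRy'⟩
  simp only at hRy
  rcases lt_trichotomy R' R with h | h | h
  · have := radius_product_lt hq hP hR' h (by rw [hRy']; exact hy)
    linarith
  · exact h
  · have := radius_product_lt hq hP hR.1 h (by rw [hRy]; exact hy)
    linarith

lemma lt_radius (hq : 1 / 2 < q) (hP : Monotone P) {R R₀ : ℝ} (hR : 1 ≤ R)
    (hpos : 0 < logFactor q R * growthFactor P R)
    (h : logFactor q R₀ * growthFactor P R₀ < logFactor q R * growthFactor P R) : R₀ < R := by
  by_contra hle
  rcases (not_lt.1 hle).eq_or_lt with he | hlt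
  · rw [he] at h; exact lt_irrefl _ h
  · exact lt_asymm h (radius_product_lt hq hP hR hlt hpos)

lemma tendsto_log_logFactor_div_log (hq : 1 / 2 < q) :
    Tendsto (fun R => Real.log (logFactor q R) / Real.log R) atTop (𝓝 0) := by
  have ha : 0 < q + 1 / 2 := by linarith
  have hlin : Tendsto (fun x : ℝ => (q + 1 / 2) * x + Real.log (15 * Real.exp 3)) atTop atTop :=
    tendsto_atTop_add_const_right _ _ (tendsto_id.const_mul_atTop ha)
  have h1 : Tendsto (fun x : ℝ => Real.log x / x) atTop (𝓝 0) := by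
    simpa using Real.isLittleO_log_id_atTop.tendsto_div_nhds_zero
  have h2 : Tendsto (fun x : ℝ => ((q + 1 / 2) * x + Real.log (15 * Real.exp 3)) / x) atTop
      (𝓝 (q + 1 / 2 + 0)) := by
    have : Tendsto (fun x : ℝ => (q + 1 / 2) + Real.log (15 * Real.exp 3) / x) atTop
        (𝓝 (q + 1 / 2 + 0)) :=
      tendsto_const_nhds.add (tendsto_const_nhds.div_atTop tendsto_id)
    refine this.congr' ?_
    filter_upwards [eventually_gt_atTop 0] with x hx
    field_simp
  have h3 := ((h1.comp hlin).mul h2).comp Real.tendsto_log_atTop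
  rw [zero_mul] at h3
  refine h3.congr' ?_
  filter_upwards [Real.tendsto_log_atTop.eventually
    (hlin.eventually_gt_atTop 0)] with R hR
  simp only [Function.comp_apply, logFactor]
  exact div_mul_div_cancel₀ hR.ne'

/-- Eventually `P ≤ growthFactor ≤ 2P` and `P ≥ R`, with `P` taken at `2R + 1`, so the reciprocal
ratio is squeezed between `1` and `1 + log (logFactor) / log R + log 2 / log P`. -/
lemma tendsto_log_ratio (hq : 1 / 2 < q) {c : ℝ} (hc : ∀ s, s - c ≤ P s) :
    Tendsto (fun R => Real.log (P (2 * R + 1)) /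
      Real.log (logFactor q R * growthFactor P R)) atTop (𝓝 1) := by
  have hlogR : ∀ᶠ R : ℝ in atTop, Real.log R ≤ 1 / 4 * R := by
    filter_upwards [Real.isLittleO_log_id_atTop.bound (by norm_num : (0 : ℝ) < 1 / 4),
      eventually_ge_atTop 1] with R h hR
    rw [Real.norm_of_nonneg (Real.log_nonneg hR), id, Real.norm_of_nonneg (by linarith)] at h
    exact h
  have hP : ∀ᶠ R : ℝ in atTop, R ≤ P (2 * R + 1) ∧ 1 + Real.log (2 * R) ≤ P (2 * R + 1) := by
    filter_upwards [hlogR, eventually_ge_atTop 1, eventually_ge_atTop (c + 2)] with R h1 h2 h3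
    have h4 := hc (2 * R + 1)
    have h5 : Real.log (2 * R) = Real.log 2 + Real.log R :=
      Real.log_mul two_ne_zero (by linarith)
    have h6 : Real.log 2 ≤ 1 := by linarith [Real.log_two_lt_d9]
    constructor <;> linarith
  have hw : Tendsto (fun R => Real.log (P (2 * R + 1))) atTop atTop :=
    Real.tendsto_log_atTop.comp (tendsto_atTop_mono' _ (hP.mono fun R h => h.1) tendsto_id)
  have hup : Tendsto (fun R => 1 + (Real.log (logFactor q R) / Real.log R +
      Real.log 2 / Real.log (P (2 * R + 1)))) atTop (𝓝 (1 + (0 + 0))) :=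
    tendsto_const_nhds.add ((tendsto_log_logFactor_div_log hq).add
      (tendsto_const_nhds.div_atTop hw))
  rw [add_zero, add_zero] at hup
  have hmain : Tendsto (fun R => Real.log (logFactor q R * growthFactor P R) /
      Real.log (P (2 * R + 1))) atTop (𝓝 1) := by
    refine tendsto_of_tendsto_of_tendsto_of_le_of_le' tendsto_const_nhds hup ?_ ?_
    · filter_upwards [hP, eventually_ge_atTop 2, hw.eventually_gt_atTop 0] with R h hR hwR
      have hH := one_le_logFactor hq (by linarith : 1 ≤ R)
      have hl : 0 ≤ Real.log (2 * R) := Real.log_nonneg (by linarith)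
      have hL : P (2 * R + 1) ≤ growthFactor P R := by unfold growthFactor; linarith
      rw [le_div_iff₀ hwR, one_mul]
      refine Real.log_le_log (by linarith) (hL.trans ?_)
      exact le_mul_of_one_le_left (by linarith) hH
    · filter_upwards [hP, eventually_ge_atTop 2, hw.eventually_gt_atTop 0] with R h hR hwR
      have hH := one_le_logFactor hq (by linarith : 1 ≤ R)
      have hPpos : 0 < P (2 * R + 1) := by linarith
      have hl : 0 ≤ Real.log (2 * R) := Real.log_nonneg (by linarith)
      have hLpos : 0 < growthFactor P R := by unfold growthFactor; linarith
      have hL : growthFactor P R ≤ 2 * P (2 * R + 1) := by unfold growthFactor; linarith [h.2]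
      have hlog2 := Real.log_le_log hLpos hL
      rw [Real.log_mul two_ne_zero hPpos.ne'] at hlog2
      have hfrac : Real.log (logFactor q R) / Real.log (P (2 * R + 1)) ≤
          Real.log (logFactor q R) / Real.log R := by
        have hlR : 0 < Real.log R := Real.log_pos (by linarith)
        have := Real.log_nonneg hH
        gcongr
        exact h.1
      rw [Real.log_mul (by linarith) hLpos.ne']
      calc (Real.log (logFactor q R) + Real.log (growthFactor P R)) / Real.log (P (2 * R + 1))
          ≤ (Real.log (logFactor q R) + (Real.log 2 + Real.log (P (2 * R + 1)))) /
              Real.log (P (2 * R + 1)) := by gcongr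
        _ = 1 + (Real.log (logFactor q R) / Real.log (P (2 * R + 1)) +
              Real.log 2 / Real.log (P (2 * R + 1))) := by field_simp; ring
        _ ≤ _ := by gcongr
  have := hmain.inv₀ one_ne_zero
  rw [inv_one] at this
  refine this.congr fun R => ?_
  rw [inv_div]

end Radius

/-! ### Counting the zeros and estimating the area -/

lemma two_div_pi_le : 2 / Real.pi ≤ 0.6367 := by
  rw [div_le_iff₀ Real.pi_pos]
  linarith [Real.pi_gt_d4]

lemma log_ratio_ge : (0.643 : ℝ) ≤ Real.log (40 / 21) := by
  have h1 : Real.log (40 / 21) = Real.log 2 - Real.log (21 / 20) := by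
    rw [← Real.log_div (by norm_num) (by norm_num)]; norm_num
  have h2 := Real.log_le_sub_one_of_pos (by norm_num : (0 : ℝ) < 21 / 20)
  linarith [Real.log_two_gt_d9]

/-- Convexity: `x + 1` lies on the segment from `1` to `2R + 1`, and the chord is linear in `x`,
which makes its circle average explicit. -/
lemma youngDual_circle_le {p : ℝ → ℝ} (hP : FiniteDual p) {R x : ℝ} (hR : 0 < R) (hx0 : 0 ≤ x)
    (hx : x ≤ 2 * R) :
    youngDual p (x + 1) ≤ |youngDual p 1| + youngDual p (2 * R + 1) / (2 * R) * x := by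
  have hlam : 0 ≤ x / (2 * R) := by positivity
  have hlam1 : x / (2 * R) ≤ 1 := (div_le_one (by positivity)).2 hx
  have h := hP.convexOn.2 (Set.mem_univ (2 * R + 1)) (Set.mem_univ 1) hlam
    (sub_nonneg.2 hlam1) (add_sub_cancel _ _)
  simp only [smul_eq_mul] at h
  rw [show x / (2 * R) * (2 * R + 1) + (1 - x / (2 * R)) * 1 = x + 1 by field_simp; ring] at h
  have h2 : (1 - x / (2 * R)) * youngDual p 1 ≤ |youngDual p 1| :=
    (mul_le_mul_of_nonneg_left (le_abs_self _) (sub_nonneg.2 hlam1)).trans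
      (mul_le_of_le_one_left (abs_nonneg _) (by linarith))
  have h3 : x / (2 * R) * youngDual p (2 * R + 1) = youngDual p (2 * R + 1) / (2 * R) * x := by
    ring
  linarith

/-- Growth and Jensen average on the circle `|z| = 2 R` for a function dominated by the Laplace
transform. -/
lemma circle_bounds {φ : ℝ → ℂ} (hφ : Integrable φ) (hsupp : ¬ HasEssCompactSupport φ)
    (hP : FiniteDual (tailExponent φ)) {f : ℂ → ℂ} (hf : Differentiable ℂ f) {R : ℝ} (hR : 1 ≤ R)
    (hpos : 0 ≤ youngDual (tailExponent φ) (2 * R + 1))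
    (hfle : ∀ z, ‖z‖ = 2 * R → ‖f z‖ ≤ ‖laplace φ z‖) :
    (∀ z, ‖z‖ = 2 * R → ‖f z‖ ≤
      Real.exp (Real.log (1 + 2 * R) + youngDual (tailExponent φ) (2 * R + 1))) ∧
    Real.circleAverage (fun z => Real.log ‖f z‖) 0 (2 * R) ≤
      Real.log (1 + 2 * R) + |youngDual (tailExponent φ) 1| +
        youngDual (tailExponent φ) (2 * R + 1) * (2 / Real.pi) := by
  set P := youngDual (tailExponent φ) with hPdef
  have hR0 : 0 < R := by linarith
  have hre : ∀ z : ℂ, ‖z‖ = 2 * R → |z.re| ≤ 2 * R := fun z hz => hz ▸ Complex.abs_re_le_norm z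
  have hbound : ∀ z, ‖z‖ = 2 * R → ‖f z‖ ≤ Real.exp (Real.log (1 + 2 * R) + P (|z.re| + 1)) := by
    intro z hz
    refine (hfle z hz).trans ((norm_laplace_le hφ hsupp hP z).trans ?_)
    rw [Real.exp_add, Real.exp_log (by positivity)]
    gcongr
    exact hre z hz
  have hlogn : 0 ≤ Real.log (1 + 2 * R) := Real.log_nonneg (by linarith)
  refine ⟨fun z hz => (hbound z hz).trans (Real.exp_le_exp.2 ?_), ?_⟩
  · have := hP.monotone (by linarith [hre z hz] : |z.re| + 1 ≤ 2 * R + 1)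
    linarith
  have havg := circleAverage_add_mul_abs_re (Real.log (1 + 2 * R) + |P 1|)
    (P (2 * R + 1) / (2 * R)) (ρ := 2 * R) (by positivity)
  have e : Real.log (1 + 2 * R) + |P 1| + P (2 * R + 1) / (2 * R) * (2 * R * (2 / Real.pi)) =
      Real.log (1 + 2 * R) + |P 1| + P (2 * R + 1) * (2 / Real.pi) := by
    field_simp
  rw [← e, ← havg]
  refine Real.circleAverage_mono ?_ ?_ ?_
  · exact MeromorphicOn.circleIntegrable_log_norm fun z _ => (hf.analyticAt z).meromorphicAt
  · exact ContinuousOn.circleIntegrable' (by fun_prop)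
  · intro z hz
    rw [abs_of_pos (by positivity), mem_sphere_zero_iff_norm] at hz
    -- At a zero `Real.log 0 = 0`, so the majorant must be nonnegative; `|P 1|` in place of `P 1`
    -- helps ensure this.
    rcases eq_or_ne (f z) 0 with h0 | h0
    · simp only [h0, norm_zero, Real.log_zero]
      positivity
    · have h1 := (Real.log_le_iff_le_exp (norm_pos_iff.2 h0)).2 (hbound z hz)
      have h2 := youngDual_circle_le hP hR0 (abs_nonneg z.re) (hre z hz)
      rw [← hPdef] at h2
      linarith

/-- Lower bound for the Laplace transform on `|z| ≤ R`, with at most `growthFactor` many roots. -/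
lemma exists_laplace_lower_bound {φ : ℝ → ℂ} (hφ : Integrable φ)
    (hsupp : ¬ HasEssCompactSupport φ) (hP : FiniteDual (tailExponent φ)) :
    ∃ K : ℝ, ∀ᶠ R : ℝ in atTop, ∃ s : Multiset ℂ,
      (s.card : ℝ) ≤ growthFactor (youngDual (tailExponent φ)) R ∧
      ∀ z, ‖z‖ ≤ R → ‖rootProd s z‖ / (3 * R) ^ s.card *
        Real.exp (-(40 * growthFactor (youngDual (tailExponent φ)) R + K)) ≤ ‖laplace φ z‖ := by
  obtain ⟨w, hw⟩ := exists_laplace_ne_zero hφ hsupp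
  obtain ⟨m, f, hf, hf0, hΦ⟩ := exists_eq_pow_mul (differentiable_laplace hφ hsupp hP) hw
  set P := youngDual (tailExponent φ) with hPdef
  set k := Real.log ‖f 0‖ with hk
  refine ⟨40 - 41 * k, ?_⟩
  have hlin : ∀ s, s - tailExponent φ 1 ≤ P s := fun s => by
    simpa using hP.linear_le zero_le_one s
  have hPtop : Tendsto (fun R : ℝ => P (2 * R + 1)) atTop atTop := by
    refine tendsto_atTop_mono' _ ?_
      (tendsto_atTop_add_const_right atTop (-tailExponent φ 1) tendsto_id)
    filter_upwards [eventually_ge_atTop 0] with R hR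
    have := hlin (2 * R + 1)
    simp only [id]
    linarith
  have hlogR : ∀ᶠ R : ℝ in atTop, Real.log R ≤ 0.001 * R := by
    filter_upwards [Real.isLittleO_log_id_atTop.bound (by norm_num : (0 : ℝ) < 0.001),
      eventually_ge_atTop 1] with R h hR
    rwa [Real.norm_of_nonneg (Real.log_nonneg hR), id, Real.norm_of_nonneg (by linarith)] at h
  filter_upwards [eventually_ge_atTop 1, hPtop.eventually_ge_atTop 0, hlogR,
    hPtop.eventually_ge_atTop (1000 * (|P 1| + |k| + m + 2)),
    eventually_ge_atTop (tailExponent φ 1)] with R hR hP0 hlog hPbig hRp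
  have hR0 : 0 < R := by linarith
  have hfle : ∀ z, ‖z‖ = 2 * R → ‖f z‖ ≤ ‖laplace φ z‖ := by
    intro z hz
    rw [hΦ z, norm_mul, norm_pow, hz]
    exact le_mul_of_one_le_left (norm_nonneg _) (one_le_pow₀ (by linarith))
  obtain ⟨hM, hA⟩ := circle_bounds hφ hsupp hP hf hR hP0 hfle
  obtain ⟨s, hcard, hlow⟩ := exists_rootProd_lower_bound hf hf0 hR0 hM hA
  have hlog3 : Real.log (1 + 2 * R) ≤ 2 + Real.log R := by
    have h1 : Real.log (1 + 2 * R) ≤ Real.log (3 * R) :=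
      Real.log_le_log (by positivity) (by linarith)
    rw [Real.log_mul (by norm_num) hR0.ne'] at h1
    have := Real.log_le_sub_one_of_pos (by norm_num : (0 : ℝ) < 3)
    linarith
  have hlogM : Real.log (1 + 2 * R) ≤ 1 + Real.log (2 * R) := by
    have h1 : Real.log (1 + 2 * R) ≤ Real.log (2 * (2 * R)) :=
      Real.log_le_log (by positivity) (by linarith)
    rw [Real.log_mul two_ne_zero (by positivity)] at h1
    linarith [Real.log_two_lt_d9]
  have hlog2 : 0 ≤ Real.log (2 * R) := Real.log_nonneg (by linarith)
  have hRP : R ≤ P (2 * R + 1) := by linarith [hlin (2 * R + 1)]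
  -- The `m` copies of `0` restore the zero at the origin. The count works because `0.643 - 0.6367 =
  -- 0.0063`: this share of `P (2R+1)` pays for `log (1 + 2R)`, at most `2 + 0.001 R`, and for the
  -- fixed constants.
  refine ⟨s + Multiset.replicate m 0, ?_, fun z hz => ?_⟩
  · rw [Multiset.card_add, Multiset.card_replicate]
    have h1 : (s.card : ℝ) * 0.643 ≤ s.card * Real.log (40 / 21) :=
      mul_le_mul_of_nonneg_left log_ratio_ge (Nat.cast_nonneg _)
    have h2 := mul_le_mul_of_nonneg_left two_div_pi_le hP0
    have h3 := neg_abs_le k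
    have h4 : (0 : ℝ) ≤ m := Nat.cast_nonneg m
    have h5 := abs_nonneg (P 1)
    have h6 := abs_nonneg k
    unfold growthFactor
    push_cast
    linarith
  · have e1 : ‖rootProd (s + Multiset.replicate m 0) z‖ = ‖rootProd s z‖ * ‖z‖ ^ m := by
      simp [rootProd]
    rw [e1, Multiset.card_add, Multiset.card_replicate, hΦ z, norm_mul, norm_pow, pow_add]
    have h3R : 1 ≤ (3 * R) ^ m := one_le_pow₀ (by linarith)
    have hexp : Real.exp (-(40 * growthFactor P R + (40 - 41 * k))) ≤
        Real.exp (k - 40 * (Real.log (1 + 2 * R) + P (2 * R + 1) - k + 1)) := by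
      rw [Real.exp_le_exp]
      unfold growthFactor
      linarith
    calc ‖rootProd s z‖ * ‖z‖ ^ m / ((3 * R) ^ s.card * (3 * R) ^ m) *
          Real.exp (-(40 * growthFactor P R + (40 - 41 * k)))
        ≤ ‖rootProd s z‖ * ‖z‖ ^ m / ((3 * R) ^ s.card * 1) *
          Real.exp (k - 40 * (Real.log (1 + 2 * R) + P (2 * R + 1) - k + 1)) := by gcongr
      _ = ‖z‖ ^ m * (‖rootProd s z‖ / (3 * R) ^ s.card *
          Real.exp (k - 40 * (Real.log (1 + 2 * R) + P (2 * R + 1) - k + 1))) := by ring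
      _ ≤ ‖z‖ ^ m * ‖f z‖ := by
          gcongr
          exact hlow z hz

/-- The area estimate for the sublevel sets of the Laplace transform, for large radii. -/
lemma eventually_volume_le {φ : ℝ → ℂ} (hφ : Integrable φ)
    (hsupp : ¬ HasEssCompactSupport φ) (hP : FiniteDual (tailExponent φ)) {q : ℝ}
    (hq : 1 / 2 < q) :
    ∀ᶠ R : ℝ in atTop, volume {z : ℂ | ‖laplace φ z‖ ≤
        Real.exp (-(logFactor q R * growthFactor (youngDual (tailExponent φ)) R)) ∧ ‖z‖ ≤ R} ≤
      ENNReal.ofReal (R ^ (-q + 1 / 2)) := by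
  obtain ⟨K, hK⟩ := exists_laplace_lower_bound hφ hsupp hP
  set P := youngDual (tailExponent φ) with hPdef
  have hlin : ∀ s, s - tailExponent φ 1 ≤ P s := fun s => by
    simpa using hP.linear_le zero_le_one s
  have hlogtop : Tendsto (fun R : ℝ => (q / 2 - 1 / 4) * Real.log R) atTop atTop :=
    Real.tendsto_log_atTop.const_mul_atTop (by linarith)
  filter_upwards [hK, eventually_ge_atTop 1, hlogtop.eventually_ge_atTop 47,
    (tendsto_growthFactor hlin).eventually_ge_atTop (|K| + 1)] with R ⟨s, hcard, hlow⟩ hR hlog hL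
  set L := growthFactor P R with hLdef
  have hR0 : 0 < R := by linarith
  -- The scale is chosen so that `r²` is exactly the desired area.
  set r : ℝ := R ^ ((-q + 1 / 2) / 2) with hr
  have hr0 : 0 < r := Real.rpow_pos_of_pos hR0 _
  have hrsq : r ^ 2 = R ^ (-q + 1 / 2) := by
    rw [hr, ← Real.rpow_natCast, ← Real.rpow_mul hR0.le]
    congr 1; push_cast; ring
  have hlogr : Real.log (3 * R / r) = Real.log 3 + (3 / 4 + q / 2) * Real.log R := by
    rw [Real.log_div (by positivity) hr0.ne', Real.log_mul (by norm_num) hR0.ne', hr,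
      Real.log_rpow hR0]
    ring
  set N : ℝ := (s.card : ℝ) with hN
  have hN0 : 0 ≤ N := Nat.cast_nonneg _
  set B : ℝ := logFactor q R * L - (40 * L + K) - N * Real.log (3 * R / r) with hB
  -- The threshold `47` covers `40` from the lower bound, `4` to beat `π`, at most `2` for `log 3`,
  -- and `1` to leave a spare `L ≥ |K| + 1`.
  have hBN : 4 * N + 1 ≤ B := by
    have h0 : 0 ≤ Real.log R := Real.log_nonneg hR
    have hlog3 : Real.log 3 ≤ 2 := by
      linarith [Real.log_le_sub_one_of_pos (by norm_num : (0 : ℝ) < 3)]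
    have hlog3' : 0 ≤ Real.log 3 := Real.log_nonneg (by norm_num)
    have hlogr0 : 0 ≤ Real.log (3 * R / r) := by rw [hlogr]; positivity
    have h1 : N * (Real.log (3 * R / r) + 4) ≤ L * (Real.log (3 * R / r) + 4) :=
      mul_le_mul_of_nonneg_right hcard (by linarith)
    have hL0 : 0 ≤ L := by linarith [abs_nonneg K]
    have h2 : 1 ≤ logFactor q R - 40 - (Real.log (3 * R / r) + 4) := by
      rw [hlogr]
      unfold logFactor
      linarith [one_le_log_const]
    have h3 := mul_le_mul_of_nonneg_right h2 hL0
    have := le_abs_self K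
    rw [hB]
    linarith
  have hB0 : 0 < B := by linarith
  have hsub : {z : ℂ | ‖laplace φ z‖ ≤ Real.exp (-(logFactor q R * L)) ∧ ‖z‖ ≤ R} ⊆
      {z : ℂ | ‖rootProd s z‖ / r ^ s.card ≤ Real.exp (-B)} := by
    rintro z ⟨hz, hzR⟩
    have h1 := (hlow z hzR).trans hz
    have hfac : (3 * R / r) ^ s.card = Real.exp (N * Real.log (3 * R / r)) := by
      rw [hN, Real.exp_nat_mul, Real.exp_log (by positivity)]
    have hE := Real.exp_pos (-(40 * L + K))
    calc ‖rootProd s z‖ / r ^ s.card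
        = ‖rootProd s z‖ / (3 * R) ^ s.card * Real.exp (-(40 * L + K)) *
            (Real.exp (40 * L + K) * (3 * R / r) ^ s.card) := by
          rw [Real.exp_neg, div_pow]
          field_simp
      _ ≤ Real.exp (-(logFactor q R * L)) * (Real.exp (40 * L + K) * (3 * R / r) ^ s.card) := by
          gcongr
      _ = Real.exp (-B) := by
          rw [hfac, ← Real.exp_add, ← Real.exp_add, hB]
          congr 1; ring
  refine (measure_mono hsub).trans ((volume_rootProd_le hr0 hB0 s).trans
    (ENNReal.ofReal_le_ofReal ?_))
  rw [← hrsq, div_le_iff₀ hB0, ← hN]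
  have h1 : N * Real.pi ≤ B := by
    have := mul_le_mul_of_nonneg_left Real.pi_le_four hN0
    linarith
  calc N * (Real.pi * r ^ 2) = r ^ 2 * (N * Real.pi) := by ring
    _ ≤ r ^ 2 * B := by gcongr

end SmallValue

theorem theorem6 (φ : ℝ → ℂ) (hφ : Integrable φ)
    (hsupp : ¬ SmallValue.HasEssCompactSupport φ)
    (hp : Tendsto (fun s : ℝ => SmallValue.tailExponent φ s / s) atTop atTop)
    (q : ℝ) (hq : 1 / 2 < q) :
    ∃ ε₀ : ℝ, 0 < ε₀ ∧
      (∀ ε ∈ Set.Ioo 0 ε₀, ∃! r : ℝ, SmallValue.IsRadius φ q ε r) ∧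
      ∀ R : ℝ → ℝ, (∀ ε ∈ Set.Ioo 0 ε₀, SmallValue.IsRadius φ q ε (R ε)) →
        (∀ ε ∈ Set.Ioo 0 ε₀,
          volume {z : ℂ | ‖SmallValue.laplace φ z‖ ≤ ε ∧ ‖z‖ ≤ R ε} ≤
            ENNReal.ofReal (R ε ^ (-q + 1 / 2))) ∧
        Tendsto
          (fun ε : ℝ =>
            Real.log (SmallValue.youngDual (SmallValue.tailExponent φ) (2 * R ε + 1)) /
              Real.log (Real.log (1 / ε)))
          (𝓝[>] 0) (𝓝 1) := by
  have hP := SmallValue.finiteDual_of_tendsto (SmallValue.tailExponent_mono hφ hsupp) hp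
  set P := SmallValue.youngDual (SmallValue.tailExponent φ) with hPdef
  have hlin : ∀ s, s - SmallValue.tailExponent φ 1 ≤ P s := fun s => by
    simpa using hP.linear_le zero_le_one s
  set G : ℝ → ℝ := fun R => SmallValue.logFactor q R * SmallValue.growthFactor P R with hG
  have hrad : ∀ ε R, SmallValue.IsRadius φ q ε R ↔ 1 ≤ R ∧ G R = -Real.log ε :=
    fun ε R => Iff.rfl
  obtain ⟨R₀, hR₀⟩ := eventually_atTop.1 (SmallValue.eventually_volume_le hφ hsupp hP hq)
  -- For `-log ε > Y` the equation is solvable from `R = 1` onwards, its solution exceeds `R₀`, and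
  -- the right-hand side is positive.
  set Y := max (max (G 1) (G R₀)) 0 with hY
  have hYε : ∀ ε ∈ Set.Ioo 0 (Real.exp (-Y)), Y < -Real.log ε := by
    rintro ε ⟨h0, h1⟩
    have := (Real.log_lt_iff_lt_exp h0).2 h1
    linarith
  have hY0 : 0 ≤ Y := le_max_right _ _
  have hY1 : G 1 ≤ Y := (le_max_left _ _).trans (le_max_left _ _)
  have hYR : G R₀ ≤ Y := (le_max_right _ _).trans (le_max_left _ _)
  refine ⟨Real.exp (-Y), Real.exp_pos _, fun ε hε => ?_, fun R hR => ⟨fun ε hε => ?_, ?_⟩⟩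
  · have h := hYε ε hε
    exact SmallValue.existsUnique_radius hq hP.monotone hP.continuous hlin
      (by linarith : 0 < -Real.log ε) (hY1.trans h.le)
  · obtain ⟨h1, h2⟩ := (hrad _ _).1 (hR ε hε)
    have h := hYε ε hε
    have hlt : R₀ < R ε := SmallValue.lt_radius hq hP.monotone h1
      (by change 0 < G (R ε); linarith) (by change G R₀ < G (R ε); linarith)
    have hexp : Real.exp (-G (R ε)) = ε := by rw [h2, neg_neg, Real.exp_log hε.1]
    have := hR₀ (R ε) hlt.le
    change volume {z : ℂ | ‖SmallValue.laplace φ z‖ ≤ Real.exp (-G (R ε)) ∧ ‖z‖ ≤ R ε} ≤ _ at this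
    rwa [hexp] at this
  · have hmem : ∀ᶠ ε : ℝ in 𝓝[>] 0, ε ∈ Set.Ioo 0 (Real.exp (-Y)) :=
      Ioo_mem_nhdsGT (Real.exp_pos _)
    have hlogtop : Tendsto (fun ε : ℝ => -Real.log ε) (𝓝[>] 0) atTop :=
      tendsto_neg_atBot_atTop.comp Real.tendsto_log_nhdsGT_zero
    have hRtop : Tendsto R (𝓝[>] 0) atTop := by
      refine tendsto_atTop.2 fun b => ?_
      filter_upwards [hmem, hlogtop.eventually_gt_atTop (G b)] with ε hε hb
      obtain ⟨h1, h2⟩ := (hrad _ _).1 (hR ε hε)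
      have h := hYε ε hε
      exact (SmallValue.lt_radius hq hP.monotone h1
        (by change 0 < G (R ε); linarith) (by change G b < G (R ε); linarith)).le
    refine ((SmallValue.tendsto_log_ratio hq hlin).comp hRtop).congr' ?_
    filter_upwards [hmem] with ε hε
    obtain ⟨_, h2⟩ := (hrad _ _).1 (hR ε hε)
    have h3 : Real.log (1 / ε) = G (R ε) := by rw [h2, one_div, Real.log_inv]
    rw [h3]
    rfl
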